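/- Let $n\ge 1$. For a locally integrable function $f$ on $\mathbb R^n$ let $M_{\mathrm S}f(x)=\sup_{R\ni x}\frac1{|R|}\int_R|f|$ be the strong maximal function, where the supremum is over all bounded, nonempty, open rectangular parallelepipeds $R\subset\mathbb R^n$ containing $x$ whose sides are parallel to the coordinate axes. For $\alpha\in(0,1)$ let \[ C_{\mathrm S}(\alpha)=\sup_{E}\frac{1}{|E|}\bigl|\{x\in\mathbb R^n: M_{\mathrm S}\chi_E(x)>\alpha\}\bigr| \] be the associated sharp Tauberian constant, where the supremum is over all measurable $E\subset\mathbb R^n$ with $0<|E|<\infty$. Then $C_{\mathrm S}(\alpha)<\infty$ for every $\alpha\in(0,1)$, and $C_{\mathrm S}\in C^{1/n}(0,1)$, that is, $C_{\mathrm S}$ is locally H\"older continuous with exponent $1/n$ on $(0,1)$: for every compact $K\subset(0,1)$ there is a constant $C\ge 0$ (depending on $n$ and $K$) such that \[ |C_{\mathrm S}(x)-C_{\mathrm S}(y)|\le C\,|x-y|^{1/n}\qquad\text{for all }x,y\in K . \] -/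

import Mathlib

open MeasureTheory Set
open scoped NNReal ENNReal

noncomputable section

/-- The maximal operator `M_𝓑 f (x) = sup_{x ∈ R ∈ 𝓑} |R|⁻¹ ∫_R |f|` associated with a collection `𝓑`
of subsets of `ℝⁿ`. It takes values in `[0, ∞]`, so it is `0` at points which lie in no member of
`𝓑`. Here `Fin n → ℝ` carries the `n`-dimensional Lebesgue measure `volume`. -/
def maximalOperator {n : ℕ} (𝓑 : Set (Set (Fin n → ℝ))) (f : (Fin n → ℝ) → ℝ)
    (x : Fin n → ℝ) : ℝ≥0∞ :=
  ⨆ R ∈ 𝓑, ⨆ _ : x ∈ R, (∫⁻ y in R, ‖f y‖ₑ) / volume R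

/-- The halo set `{x : M_𝓑 χ_E (x) > α}`. -/
def haloSet {n : ℕ} (𝓑 : Set (Set (Fin n → ℝ))) (α : ℝ) (E : Set (Fin n → ℝ)) :
    Set (Fin n → ℝ) :=
  {x | ENNReal.ofReal α < maximalOperator 𝓑 (E.indicator fun _ => (1 : ℝ)) x}

/-- The sharp Tauberian constant `C_𝓑(α) = sup_E |{x : M_𝓑 χ_E (x) > α}| / |E|`, the supremum being
over the measurable sets `E` with `0 < |E| < ∞`, as an element of `[0, ∞]`. -/
def sharpTauberianConstant {n : ℕ} (𝓑 : Set (Set (Fin n → ℝ))) (α : ℝ) : ℝ≥0∞ :=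
  ⨆ (E : Set (Fin n → ℝ)) (_ : MeasurableSet E) (_ : 0 < volume E) (_ : volume E < ∞),
    volume (haloSet 𝓑 α E) / volume E

/-- The basis of the strong maximal operator: all (open, bounded, nonempty) rectangular
parallelepipeds in `ℝⁿ` whose sides are parallel to the coordinate axes. -/
def strongBasis (n : ℕ) : Set (Set (Fin n → ℝ)) :=
  {R | ∃ a b : Fin n → ℝ, (∀ i, a i < b i) ∧ R = univ.pi fun i => Ioo (a i) (b i)}

/-- The Hölder class `C^p(I)` of functions that are locally Hölder continuous with exponent `p`:
on every compact `K ⊆ I` one has `|f x - f y| ≤ C_K |x - y|^p`. -/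
def IsLocallyHolderOn (p : ℝ≥0) (f : ℝ → ℝ) (I : Set ℝ) : Prop :=
  ∀ K : Set ℝ, K ⊆ I → IsCompact K → ∃ C : ℝ≥0, HolderOnWith C p f K

end

/-! Write `C` for the sharp Tauberian constant. It is nonincreasing, and two further facts give the
theorem: submultiplicativity, `C(αβ) ≤ C(α) C(β)`, and Solyanik's estimate `C(1 - η^n) ≤ (1 + 4η)^n`
for `0 < η ≤ 1/4`. Finiteness follows, since powers of one level with finite constant reach below
every `α > 0`. For `x < y`, put `η^n = 1 - x/y`. Then `C(x) ≤ C(x/y) C(y) ≤ (1 + O(η)) C(y)`, and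
`η` is of order `(y - x)^(1/n)` away from `0`; this is the Hölder exponent.

Submultiplicativity comes from `haloSet_mul_subset`: the halo of level `αβ` lies in the `α`-halo of
the `β`-halo `H`. It must be shown that a box with `E`-density above `αβ` has `H`-density above `α`.
If not, the box is "defective" for a compact part of `E`. A rising sun bisection keeps this defect
in boxes shrinking to a point, which is impossible both inside and outside `H` (`not_isDefective`).

Solyanik's estimate is proved for open sets by induction on the dimension. On the line, a cover by
intervals can be thinned to multiplicity two. A box of density above `1 - η * η^n` has density above
`1 - η` on most one-dimensional slices, so its points lie in a one-dimensional halo followed by an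
`n`-dimensional one. Outer regularity extends the bound to measurable sets. -/

/-! ### Boxes and halo sets. -/

theorem volume_pi_Ioo_pos {n : ℕ} {a b : Fin n → ℝ} (h : ∀ i, a i < b i) :
    0 < volume (univ.pi fun i => Ioo (a i) (b i)) := by
  rw [Real.volume_pi_Ioo]
  exact CanonicallyOrderedAdd.prod_pos.2 fun i _ => by simpa using h i

theorem volume_pi_Ioo_lt_top {n : ℕ} (a b : Fin n → ℝ) :
    volume (univ.pi fun i => Ioo (a i) (b i)) < ∞ := by
  rw [Real.volume_pi_Ioo]
  exact ENNReal.prod_lt_top fun i _ => ENNReal.ofReal_lt_top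

theorem mem_haloSet_strongBasis {n : ℕ} {α : ℝ} {E : Set (Fin n → ℝ)} (hE : MeasurableSet E)
    {x : Fin n → ℝ} : x ∈ haloSet (strongBasis n) α E ↔
      ∃ a b : Fin n → ℝ, (∀ i, a i < b i) ∧ (x ∈ univ.pi fun i => Ioo (a i) (b i)) ∧
        ENNReal.ofReal α * volume (univ.pi fun i => Ioo (a i) (b i)) <
          volume (E ∩ univ.pi fun i => Ioo (a i) (b i)) := by
  have key : ∀ R : Set (Fin n → ℝ),
      ∫⁻ y in R, ‖E.indicator (fun _ => (1 : ℝ)) y‖ₑ = volume (E ∩ R) := by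
    intro R
    have : (fun y => ‖E.indicator (fun _ => (1 : ℝ)) y‖ₑ) = E.indicator 1 := by
      ext y
      by_cases hy : y ∈ E <;> simp [hy]
    rw [this, lintegral_indicator_one hE, Measure.restrict_apply hE]
  simp only [haloSet, maximalOperator, mem_ofPred_eq, lt_iSup_iff, key]
  constructor
  · rintro ⟨R, ⟨a, b, hab, rfl⟩, hx, h⟩
    exact ⟨a, b, hab, hx, (ENNReal.lt_div_iff_mul_lt (Or.inl (volume_pi_Ioo_pos hab).ne')
      (Or.inl (volume_pi_Ioo_lt_top a b).ne)).1 h⟩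
  · rintro ⟨a, b, hab, hx, h⟩
    exact ⟨_, ⟨a, b, hab, rfl⟩, hx, (ENNReal.lt_div_iff_mul_lt (Or.inl (volume_pi_Ioo_pos hab).ne')
      (Or.inl (volume_pi_Ioo_lt_top a b).ne)).2 h⟩

theorem haloSet_mono {n : ℕ} (𝓑 : Set (Set (Fin n → ℝ))) {α : ℝ} {E F : Set (Fin n → ℝ)}
    (h : E ⊆ F) : haloSet 𝓑 α E ⊆ haloSet 𝓑 α F := by
  intro x hx
  simp only [haloSet, mem_ofPred_eq] at hx ⊢
  refine lt_of_lt_of_le hx ?_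
  unfold maximalOperator
  gcongr with R hR hxR y
  by_cases hy : y ∈ E
  · simp [hy, h hy]
  · simp [hy]

theorem haloSet_anti {n : ℕ} (𝓑 : Set (Set (Fin n → ℝ))) {α β : ℝ} (h : α ≤ β)
    (E : Set (Fin n → ℝ)) : haloSet 𝓑 β E ⊆ haloSet 𝓑 α E := by
  intro x hx
  simp only [haloSet, mem_ofPred_eq] at hx ⊢
  exact lt_of_le_of_lt (ENNReal.ofReal_le_ofReal h) hx

theorem pi_Ioo_subset_haloSet {n : ℕ} {α : ℝ} {E : Set (Fin n → ℝ)} (hE : MeasurableSet E)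
    {a b : Fin n → ℝ} (hab : ∀ i, a i < b i)
    (h : ENNReal.ofReal α * volume (univ.pi fun i => Ioo (a i) (b i)) <
      volume (E ∩ univ.pi fun i => Ioo (a i) (b i))) :
    (univ.pi fun i => Ioo (a i) (b i)) ⊆ haloSet (strongBasis n) α E := fun _ hx =>
  (mem_haloSet_strongBasis hE).2 ⟨a, b, hab, hx, h⟩

theorem isOpen_haloSet_strongBasis {n : ℕ} {α : ℝ} {E : Set (Fin n → ℝ)} (hE : MeasurableSet E) :
    IsOpen (haloSet (strongBasis n) α E) := by
  rw [isOpen_iff_mem_nhds]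
  intro x hx
  obtain ⟨a, b, hab, hxR, h⟩ := (mem_haloSet_strongBasis hE).1 hx
  exact Filter.mem_of_superset ((isOpen_set_pi finite_univ fun i _ => isOpen_Ioo).mem_nhds hxR)
    (pi_Ioo_subset_haloSet hE hab h)

/-- Almost every point of `E` lies in every halo set of level less than one. -/
theorem ae_mem_haloSet_strongBasis {n : ℕ} (hn : 1 ≤ n) {α : ℝ} (hα : α < 1)
    {E : Set (Fin n → ℝ)} (hE : MeasurableSet E) :
    ∀ᵐ x, x ∈ E → x ∈ haloSet (strongBasis n) α E := by
  have : Nonempty (Fin n) := ⟨⟨0, hn⟩⟩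
  have h := Besicovitch.ae_tendsto_measure_inter_div (volume : Measure (Fin n → ℝ)) E
  rw [ae_restrict_iff' hE] at h
  filter_upwards [h] with x hx hxE
  have h1 : ENNReal.ofReal α < 1 := by simpa using hα
  obtain ⟨r, hr, hr0⟩ := (((hx hxE).eventually (lt_mem_nhds h1)).and self_mem_nhdsWithin).exists
  have hr0 : 0 < r := hr0
  have hball : Metric.ball x r = univ.pi fun i => Ioo (x i - r) (x i + r) := by
    rw [ball_pi _ hr0]; simp only [Real.ball_eq_Ioo]
  have hae : Metric.closedBall x r =ᵐ[volume] Metric.ball x r := by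
    rw [← Metric.ball_union_sphere]
    exact union_ae_eq_left_of_ae_eq_empty
      (ae_eq_empty.2 (Measure.addHaar_sphere_of_ne_zero volume x hr0.ne'))
  rw [measure_congr hae, measure_congr ((ae_eq_refl E).inter hae), hball] at hr
  have hlt : ∀ i, x i - r < x i + r := fun i => by linarith
  refine (mem_haloSet_strongBasis hE).2 ⟨_, _, hlt, fun i _ => ⟨by linarith, by linarith⟩, ?_⟩
  exact (ENNReal.lt_div_iff_mul_lt (Or.inl (volume_pi_Ioo_pos hlt).ne')
      (Or.inl (volume_pi_Ioo_lt_top _ _).ne)).1 hr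

/-! ### A rising sun lemma for boxes. -/

/-- One halving step of the rising sun argument. -/
theorem exists_half_of_drop {k g : ℝ → ℝ} {a b : ℝ} (hab : a < b) (hk : ContinuousOn k (Icc a b))
    (hkg : ∀ s t, a ≤ s → s < t → t ≤ b → k s = k t → g s = g t)
    (h1 : k b ≤ k a) (h2 : g b - g a < k b - k a) :
    ∃ s t, a ≤ s ∧ s < t ∧ t ≤ b ∧ t - s ≤ (b - a) / 2 ∧ k t ≤ k s ∧ g t - g s < k t - k s := by
  set m := (a + b) / 2 with hm
  have ham : a < m := by linarith
  have hmb : m < b := by linarith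
  -- If `k` rises above `k a` at the midpoint, it returns to that value at some `t ≥ m`. Both `k`
  -- and `g` agree at `a` and `t`, so `[t, b]` inherits both inequalities. The case `k m < k b` is
  -- the mirror image.
  rcases lt_or_ge (k a) (k m) with h | h
  · obtain ⟨t, ht, hkt⟩ := intermediate_value_Icc' hmb.le
      (hk.mono (Icc_subset_Icc_left ham.le)) (show k a ∈ Icc (k b) (k m) from ⟨h1, h.le⟩)
    have hg := hkg a t le_rfl (by linarith [ht.1]) ht.2 hkt.symm
    have htb : t ≠ b := by
      rintro rfl
      rw [hkt, hg] at h2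
      linarith
    refine ⟨t, b, by linarith [ht.1], lt_of_le_of_ne ht.2 htb, le_rfl, ?_, ?_, ?_⟩ <;>
      linarith [ht.1]
  rcases lt_or_ge (k m) (k b) with h' | h'
  · obtain ⟨t, ht, hkt⟩ := intermediate_value_Icc' ham.le
      (hk.mono (Icc_subset_Icc_right hmb.le)) (show k b ∈ Icc (k m) (k a) from ⟨h'.le, h1⟩)
    have hg := hkg t b ht.1 (by linarith [ht.2]) le_rfl hkt
    have hta : t ≠ a := by
      rintro rfl
      rw [← hkt, ← hg] at h2
      linarith
    refine ⟨a, t, le_rfl, lt_of_le_of_ne ht.1 hta.symm, by linarith [ht.2], ?_, ?_, ?_⟩ <;>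
      linarith [ht.2]
  -- Now `k b ≤ k m ≤ k a`, and the strict inequality is additive over the two halves, so one of
  -- them inherits it.
  rcases lt_or_ge (g m - g a) (k m - k a) with h3 | h3
  · exact ⟨a, m, le_rfl, ham, hmb.le, by linarith, h, h3⟩
  · exact ⟨m, b, ham.le, hmb, le_rfl, by linarith, h', by linarith⟩

/-- The part of `M` in a box below height `t` in direction `i` has volume whose increments are the
volumes of the parts of `M` in sub-boxes. -/
theorem volume_real_inter_pi_Ioo_update {n : ℕ} (M : Set (Fin n → ℝ)) (hM : MeasurableSet M)
    (a b : Fin n → ℝ) (i : Fin n) {s t : ℝ} (has : a i ≤ s) (hst : s ≤ t) (htb : t ≤ b i) :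
    volume.real (M ∩ univ.pi fun j => Ioo (Function.update a i s j) (Function.update b i t j)) =
      volume.real (M ∩ (univ.pi fun j => Ioo (a j) (b j)) ∩ {x | x i < t}) -
        volume.real (M ∩ (univ.pi fun j => Ioo (a j) (b j)) ∩ {x | x i < s}) := by
  set R := univ.pi fun j => Ioo (a j) (b j) with hR
  have hRm : MeasurableSet R := MeasurableSet.univ_pi fun i => measurableSet_Ioo
  have hfin : ∀ S : Set (Fin n → ℝ), volume (M ∩ R ∩ S) ≠ ∞ := fun S =>
    ((measure_mono (inter_subset_left.trans inter_subset_right)).trans_lt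
      (volume_pi_Ioo_lt_top a b)).ne
  have hm : ∀ u : ℝ, MeasurableSet {x : Fin n → ℝ | x i < u} := fun u =>
    measurableSet_lt (measurable_pi_apply i) measurable_const
  have hsub : M ∩ R ∩ {x | x i < s} ⊆ M ∩ R ∩ {x | x i < t} :=
    inter_subset_inter_right _ fun x (hx : x i < s) => lt_of_lt_of_le hx hst
  rw [← measureReal_sdiff hsub ((hM.inter hRm).inter (hm s)) (hfin _)]
  refine measureReal_congr (Filter.eventuallyEq_set.2 ?_)
  -- The two sets differ only on the face `x i = s`, which the open sub-box omits.
  have h0 : ∀ᵐ x : Fin n → ℝ, x i ≠ s :=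
    compl_mem_ae_iff.2 (Measure.pi_hyperplane (fun _ => (volume : Measure ℝ)) i s)
  filter_upwards [h0] with x hx
  simp only [mem_inter_iff, mem_sdiff, mem_ofPred_eq, hR, mem_univ_pi, mem_Ioo, not_and, not_lt]
  constructor
  · rintro ⟨h1, h2⟩
    have h3 := h2 i
    simp only [Function.update_self] at h3
    refine ⟨⟨⟨h1, fun j => ?_⟩, h3.2⟩, fun _ => h3.1.le⟩
    rcases eq_or_ne j i with rfl | hj
    · exact ⟨has.trans_lt h3.1, h3.2.trans_le htb⟩
    · simpa [hj] using h2 j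
  · rintro ⟨⟨⟨h1, h2⟩, h3⟩, h4⟩
    refine ⟨h1, fun j => ?_⟩
    rcases eq_or_ne j i with rfl | hj
    · simpa using ⟨lt_of_le_of_ne (h4 ⟨h1, h2⟩) (Ne.symm hx), h3⟩
    · simpa [hj] using h2 j

theorem continuousOn_volume_real_inter_pi_Ioo {n : ℕ} (M : Set (Fin n → ℝ)) (hM : MeasurableSet M)
    (a b : Fin n → ℝ) (i : Fin n) (hab : ∀ j, a j < b j) :
    ContinuousOn (fun t : ℝ =>
      volume.real (M ∩ (univ.pi fun j => Ioo (a j) (b j)) ∩ {x | x i < t})) (Icc (a i) (b i)) := by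
  have hc : 0 ≤ ∏ j ∈ {i}ᶜ, (b j - a j) := Finset.prod_nonneg fun j _ => by linarith [hab j]
  have key : ∀ s ∈ Icc (a i) (b i), ∀ t ∈ Icc (a i) (b i), s ≤ t →
      dist (volume.real (M ∩ (univ.pi fun j => Ioo (a j) (b j)) ∩ {x | x i < s}))
        (volume.real (M ∩ (univ.pi fun j => Ioo (a j) (b j)) ∩ {x | x i < t})) ≤
        Real.toNNReal (∏ j ∈ {i}ᶜ, (b j - a j)) * dist s t := by
    intro s hs t ht hst
    rw [Real.coe_toNNReal _ hc, dist_comm, Real.dist_eq,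
      ← volume_real_inter_pi_Ioo_update M hM a b i hs.1 hst ht.2, abs_of_nonneg measureReal_nonneg,
      dist_comm, Real.dist_eq, abs_of_nonneg (by linarith)]
    refine (measureReal_mono inter_subset_right (volume_pi_Ioo_lt_top _ _).ne).trans ?_
    rw [Measure.real, Real.volume_pi_Ioo_toReal, Fintype.prod_eq_mul_prod_compl i, mul_comm]
    · simp only [Function.update_self]
      refine le_of_eq (congrArg (· * (t - s)) (Finset.prod_congr rfl fun j hj => ?_))
      have : j ≠ i := by simpa using hj
      simp [this]
    · intro j
      rcases eq_or_ne j i with rfl | hj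
      · simpa using hst
      · simpa [hj] using (hab j).le
  refine (LipschitzOnWith.of_dist_le_mul (K := Real.toNNReal (∏ j ∈ {i}ᶜ, (b j - a j)))
    fun s hs t ht => ?_).continuousOn
  rcases le_total s t with h | h
  · exact key s hs t ht h
  · rw [dist_comm, dist_comm s t]
    exact key t ht s hs h

/-- A box on which `K` has density at most `c` although it fills more than the proportion `c` of
the part of `H` in the box. -/
structure IsDefective {n : ℕ} (K H : Set (Fin n → ℝ)) (c : ℝ) (a b : Fin n → ℝ) : Prop where
  lt : ∀ i, a i < b i
  le : volume.real (K ∩ univ.pi fun i => Ioo (a i) (b i)) ≤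
    c * volume.real (univ.pi fun i => Ioo (a i) (b i))
  gt : c * volume.real (H ∩ univ.pi fun i => Ioo (a i) (b i)) <
    volume.real (K ∩ univ.pi fun i => Ioo (a i) (b i))

/-- Cutting the box in direction `i` turns the defect into the two inequalities of
`exists_half_of_drop`, with `k = F K - c * F univ` and `g = c * F H - c * F univ`. -/
theorem IsDefective.exists_half_direction {n : ℕ} {K H : Set (Fin n → ℝ)} {c : ℝ}
    (hK : MeasurableSet K) (hH : MeasurableSet H)
    (hKH : ∀ a b : Fin n → ℝ, (∀ i, a i < b i) →
      volume.real (K ∩ univ.pi fun i => Ioo (a i) (b i)) =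
        c * volume.real (univ.pi fun i => Ioo (a i) (b i)) →
      (univ.pi fun i => Ioo (a i) (b i)) ⊆ H)
    {a b : Fin n → ℝ} (h : IsDefective K H c a b) (i : Fin n) :
    ∃ s t, a i ≤ s ∧ t ≤ b i ∧ t - s ≤ (b i - a i) / 2 ∧
      IsDefective K H c (Function.update a i s) (Function.update b i t) := by
  set F : Set (Fin n → ℝ) → ℝ → ℝ := fun M t =>
    volume.real (M ∩ (univ.pi fun j => Ioo (a j) (b j)) ∩ {x | x i < t}) with hF
  have hFM : ∀ M : Set (Fin n → ℝ), MeasurableSet M → ∀ s t, a i ≤ s → s ≤ t → t ≤ b i →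
      volume.real (M ∩ univ.pi fun j => Ioo (Function.update a i s j) (Function.update b i t j)) =
        F M t - F M s := fun M hM s t h1 h2 h3 =>
    volume_real_inter_pi_Ioo_update M hM a b i h1 h2 h3
  have hFu : ∀ s t, a i ≤ s → s ≤ t → t ≤ b i →
      volume.real (univ.pi fun j => Ioo (Function.update a i s j) (Function.update b i t j)) =
        F univ t - F univ s := fun s t h1 h2 h3 => by
    simpa using hFM univ MeasurableSet.univ s t h1 h2 h3
  have hlt : ∀ s t, s < t → ∀ j, Function.update a i s j < Function.update b i t j := by
    intro s t hst j
    rcases eq_or_ne j i with rfl | hj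
    · simpa using hst
    · simpa [hj] using h.lt j
  have hcont : ContinuousOn (fun t => F K t - c * F univ t) (Icc (a i) (b i)) :=
    (continuousOn_volume_real_inter_pi_Ioo K hK a b i h.lt).sub
      ((continuousOn_volume_real_inter_pi_Ioo univ MeasurableSet.univ a b i h.lt).const_mul c)
  have e1 := hFM K hK _ _ le_rfl (h.lt i).le le_rfl
  have e2 := hFM H hH _ _ le_rfl (h.lt i).le le_rfl
  have e3 := hFu _ _ le_rfl (h.lt i).le le_rfl
  simp only [Function.update_eq_self] at e1 e2 e3
  have hle := h.le
  have hgt := h.gt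
  rw [e1, e3] at hle
  rw [e1, e2] at hgt
  -- Equal values of `k` say that `K` has density exactly `c` in the slab between `s` and `t`; by
  -- `hKH` the slab lies in `H`, so `g` does not change across it.
  have hg : ∀ s t, a i ≤ s → s < t → t ≤ b i → F K s - c * F univ s = F K t - c * F univ t →
      c * F H s - c * F univ s = c * F H t - c * F univ t := by
    intro s t h1 h2 h3 h4
    have := hKH _ _ (hlt s t h2) (by
      rw [hFM K hK s t h1 h2.le h3, hFu s t h1 h2.le h3]
      linarith)
    have h5 := hFM H hH s t h1 h2.le h3
    rw [inter_eq_right.2 this, hFu s t h1 h2.le h3] at h5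
    have h6 : c * (F univ t - F univ s) = c * (F H t - F H s) := by rw [h5]
    linarith
  obtain ⟨s, t, h1, h2, h3, h4, h5, h6⟩ := exists_half_of_drop (h.lt i) hcont hg
    (by linarith) (by linarith)
  refine ⟨s, t, h1, h3, h4, hlt s t h2, ?_, ?_⟩
  · rw [hFM K hK s t h1 h2.le h3, hFu s t h1 h2.le h3]
    linarith
  · rw [hFM K hK s t h1 h2.le h3, hFM H hH s t h1 h2.le h3]
    linarith

theorem IsDefective.exists_half {n : ℕ} {K H : Set (Fin n → ℝ)} {c : ℝ}
    (hK : MeasurableSet K) (hH : MeasurableSet H)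
    (hKH : ∀ a b : Fin n → ℝ, (∀ i, a i < b i) →
      volume.real (K ∩ univ.pi fun i => Ioo (a i) (b i)) =
        c * volume.real (univ.pi fun i => Ioo (a i) (b i)) →
      (univ.pi fun i => Ioo (a i) (b i)) ⊆ H)
    {a b : Fin n → ℝ} (h : IsDefective K H c a b) :
    ∃ a' b', a ≤ a' ∧ b' ≤ b ∧ (∀ i, b' i - a' i ≤ (b i - a i) / 2) ∧
      IsDefective K H c a' b' := by
  suffices ∀ S : Finset (Fin n), ∃ a' b', a ≤ a' ∧ b' ≤ b ∧
      (∀ i ∈ S, b' i - a' i ≤ (b i - a i) / 2) ∧ IsDefective K H c a' b' by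
    simpa using this Finset.univ
  intro S
  induction S using Finset.induction_on with
  | empty => exact ⟨a, b, le_rfl, le_rfl, by simp, h⟩
  | insert i S _ ih =>
    obtain ⟨a', b', h1, h2, h3, h4⟩ := ih
    obtain ⟨s, t, hs, ht, hst, h5⟩ := h4.exists_half_direction hK hH hKH i
    have h1' : a' ≤ Function.update a' i s := by simpa [le_update_iff] using hs
    have h2' : Function.update b' i t ≤ b' := by simpa [update_le_iff] using ht
    refine ⟨_, _, h1.trans h1', h2'.trans h2, fun j hj => ?_, h5⟩
    rcases eq_or_ne j i with rfl | hji
    · simp only [Function.update_self]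
      linarith [h1 j, h2 j]
    · simpa [hji] using h3 j ((Finset.mem_insert.1 hj).resolve_left hji)

/-- A form of the rising sun lemma for boxes. -/
theorem not_isDefective {n : ℕ} {K H : Set (Fin n → ℝ)} {c : ℝ}
    (hK : IsClosed K) (hH : IsOpen H) (hsub : K ⊆ H) (hc : 0 ≤ c)
    (hKH : ∀ a b : Fin n → ℝ, (∀ i, a i < b i) →
      volume.real (K ∩ univ.pi fun i => Ioo (a i) (b i)) =
        c * volume.real (univ.pi fun i => Ioo (a i) (b i)) →
      (univ.pi fun i => Ioo (a i) (b i)) ⊆ H)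
    (a b : Fin n → ℝ) : ¬ IsDefective K H c a b := by
  intro h
  have step : ∀ p : {p : (Fin n → ℝ) × (Fin n → ℝ) // IsDefective K H c p.1 p.2},
      ∃ q : {p : (Fin n → ℝ) × (Fin n → ℝ) // IsDefective K H c p.1 p.2},
        p.1.1 ≤ q.1.1 ∧ q.1.2 ≤ p.1.2 ∧ ∀ i, q.1.2 i - q.1.1 i ≤ (p.1.2 i - p.1.1 i) / 2 := by
    rintro ⟨⟨a, b⟩, hp⟩
    obtain ⟨a', b', h1, h2, h3, h4⟩ := hp.exists_half hK.measurableSet hH.measurableSet hKH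
    exact ⟨⟨⟨a', b'⟩, h4⟩, h1, h2, h3⟩
  choose f hf1 hf2 hf3 using step
  let p : ℕ → {p : (Fin n → ℝ) × (Fin n → ℝ) // IsDefective K H c p.1 p.2} :=
    fun k => f^[k] ⟨(a, b), h⟩
  have hp : ∀ k, p (k + 1) = f (p k) := fun k => Function.iterate_succ_apply' f k _
  obtain ⟨x, hx⟩ := IsCompact.nonempty_iInter_of_sequence_nonempty_isCompact_isClosed
    (fun k => Icc (p k).1.1 (p k).1.2)
    (fun k => by
      simp only [hp]
      exact Icc_subset_Icc (hf1 _) (hf2 _))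
    (fun k => nonempty_Icc.2 fun i => ((p k).2.lt i).le)
    isCompact_Icc (fun k => isClosed_Icc)
  rw [mem_iInter] at hx
  have hlen : ∀ k i, (p k).1.2 i - (p k).1.1 i ≤ (b i - a i) / 2 ^ k := by
    intro k i
    induction k with
    | zero => simp [p]
    | succ k ih =>
      rw [hp, pow_succ, ← div_div]
      exact (hf3 _ i).trans (by linarith)
  have small : ∀ U : Set (Fin n → ℝ), IsOpen U → x ∈ U →
      ∃ k, (univ.pi fun i => Ioo ((p k).1.1 i) ((p k).1.2 i)) ⊆ U := by
    intro U hU hxU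
    obtain ⟨ε, hε, hεU⟩ := Metric.isOpen_iff.1 hU x hxU
    have hlim : ∀ᶠ k : ℕ in Filter.atTop, ∀ i, (b i - a i) / 2 ^ k < ε := by
      rw [Filter.eventually_all]
      intro i
      have := tendsto_const_nhds (x := b i - a i) (f := Filter.atTop) |>.div_atTop
        (tendsto_pow_atTop_atTop_of_one_lt (r := (2 : ℝ)) (by norm_num))
      exact this.eventually (gt_mem_nhds hε)
    obtain ⟨k, hk⟩ := hlim.exists
    refine ⟨k, fun y hy => hεU ((dist_pi_lt_iff hε).2 fun i => ?_)⟩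
    have h1 := hy i (mem_univ i)
    have h2 := (hx k).1 i
    have h3 := (hx k).2 i
    have h4 := hlen k i
    have h5 := hk i
    rw [Real.dist_eq, abs_lt]
    constructor <;> linarith [h1.1, h1.2]
  -- Inside `H`, a small box has `H ∩ R = R`, and the two inequalities of a defect contradict each
  -- other. Outside `H`, a small box misses the closed set `K`, so its `K`-volume cannot be
  -- positive.
  by_cases hxH : x ∈ H
  · obtain ⟨k, hk⟩ := small H hH hxH
    have h1 := (p k).2.le
    have h2 := (p k).2.gt
    rw [inter_eq_right.2 hk] at h2
    exact absurd h1 (not_le.2 h2)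
  · obtain ⟨k, hk⟩ := small Kᶜ hK.isOpen_compl fun hxK => hxH (hsub hxK)
    have h2 := (p k).2.gt
    rw [(disjoint_iff_inter_eq_empty (s := K)).1 (subset_compl_iff_disjoint_left.1 hk)] at h2
    simp only [measureReal_empty] at h2
    exact absurd h2 (not_lt.2 (mul_nonneg hc measureReal_nonneg))

/-! ### Submultiplicativity of the Tauberian constant. -/

theorem ofReal_mul_volume_lt_iff {n : ℕ} {α : ℝ} (hα : 0 ≤ α) (E : Set (Fin n → ℝ))
    (a b : Fin n → ℝ) :
    ENNReal.ofReal α * volume (univ.pi fun i => Ioo (a i) (b i)) <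
      volume (E ∩ univ.pi fun i => Ioo (a i) (b i)) ↔
    α * volume.real (univ.pi fun i => Ioo (a i) (b i)) <
      volume.real (E ∩ univ.pi fun i => Ioo (a i) (b i)) := by
  have h1 := (volume_pi_Ioo_lt_top a b).ne
  have h2 : volume (E ∩ univ.pi fun i => Ioo (a i) (b i)) ≠ ∞ :=
    ((measure_mono inter_subset_right).trans_lt (volume_pi_Ioo_lt_top a b)).ne
  rw [Measure.real, Measure.real, ← ENNReal.toReal_lt_toReal
    (ENNReal.mul_ne_top ENNReal.ofReal_ne_top h1) h2, ENNReal.toReal_mul, ENNReal.toReal_ofReal hα]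

/-- Halo sets of product level are contained in iterated halo sets. -/
theorem haloSet_mul_subset {n : ℕ} (hn : 1 ≤ n) {α β : ℝ} (hα : α ∈ Ioo (0 : ℝ) 1)
    (hβ : β ∈ Ioo (0 : ℝ) 1) {E : Set (Fin n → ℝ)} (hE : MeasurableSet E) :
    haloSet (strongBasis n) (α * β) E ⊆
      haloSet (strongBasis n) α (haloSet (strongBasis n) β E) := by
  intro x hx
  obtain ⟨a, b, hab, hxR, h⟩ := (mem_haloSet_strongBasis hE).1 hx
  have hHo : IsOpen (haloSet (strongBasis n) β E) := isOpen_haloSet_strongBasis hE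
  have hbox : ∀ p q : Fin n → ℝ, (∀ i, p i < q i) →
      β * volume.real (univ.pi fun i => Ioo (p i) (q i)) <
        volume.real (E ∩ univ.pi fun i => Ioo (p i) (q i)) →
      (univ.pi fun i => Ioo (p i) (q i)) ⊆ haloSet (strongBasis n) β E := fun p q hpq h' =>
    pi_Ioo_subset_haloSet hE hpq ((ofReal_mul_volume_lt_iff hβ.1.le E p q).2 h')
  have hpos : ∀ p q : Fin n → ℝ, (∀ i, p i < q i) →
      0 < volume.real (univ.pi fun i => Ioo (p i) (q i)) := fun p q hpq =>
    ENNReal.toReal_pos (volume_pi_Ioo_pos hpq).ne' (volume_pi_Ioo_lt_top p q).ne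
  have hae := ae_mem_haloSet_strongBasis hn hβ.2 hE
  rw [ofReal_mul_volume_lt_iff (mul_pos hα.1 hβ.1).le] at h
  refine (mem_haloSet_strongBasis hHo.measurableSet).2 ⟨a, b, hab, hxR, ?_⟩
  rw [ofReal_mul_volume_lt_iff hα.1.le]
  set H := haloSet (strongBasis n) β E with hH
  set R := univ.pi fun i => Ioo (a i) (b i) with hR
  have hRm : MeasurableSet R := MeasurableSet.univ_pi fun i => measurableSet_Ioo
  have hv : 0 < volume.real R := hpos a b hab
  rcases lt_or_ge (β * volume.real R) (volume.real (E ∩ R)) with h1 | h1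
  · rw [inter_eq_right.2 (hbox a b hab h1)]
    exact mul_lt_of_lt_one_left hv hα.2
  have h2 : β < volume.real (E ∩ R) / (α * volume.real R) := by
    rw [lt_div_iff₀ (mul_pos hα.1 hv)]
    linarith
  -- Strictness on both sides matters: `β < c` puts every box of `K`-density exactly `c` into `H`,
  -- and the upper bound leaves room to replace `E` by a compact `K`.
  obtain ⟨c, hc1, hc2⟩ := exists_between h2
  have hc0 : 0 < c := hβ.1.trans hc1
  rw [lt_div_iff₀ (mul_pos hα.1 hv)] at hc2
  have hfin : volume (E ∩ R) ≠ ∞ :=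
    ((measure_mono inter_subset_right).trans_lt (volume_pi_Ioo_lt_top a b)).ne
  have hEH : volume (E ∩ H ∩ R) = volume (E ∩ R) := by
    refine measure_congr (Filter.eventuallyEq_set.2 ?_)
    filter_upwards [hae] with y hy
    simp only [mem_inter_iff]
    tauto
  obtain ⟨K, hKsub, hK, hKv⟩ := ((hE.inter hHo.measurableSet).inter hRm).exists_lt_isCompact
    (μ := volume) (r := ENNReal.ofReal (c * (α * volume.real R))) (by
      rw [hEH]
      exact (ENNReal.ofReal_lt_iff_lt_toReal (by have := hα.1; positivity) hfin).2 hc2)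
  have hKE : K ⊆ E := fun y hy => (hKsub hy).1.1
  have hKR : K ∩ R = K := inter_eq_left.2 fun y hy => (hKsub hy).2
  rw [ENNReal.ofReal_lt_iff_lt_toReal (by have := hα.1; positivity)
    ((measure_mono fun y hy => ⟨hKE hy, (hKsub hy).2⟩ : volume K ≤ volume (E ∩ R)).trans_lt
      hfin.lt_top).ne] at hKv
  have hmono : ∀ p q : Fin n → ℝ, volume.real (K ∩ univ.pi fun i => Ioo (p i) (q i)) ≤
      volume.real (E ∩ univ.pi fun i => Ioo (p i) (q i)) := fun p q =>
    measureReal_mono (inter_subset_inter_left _ hKE)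
      ((measure_mono inter_subset_right).trans_lt (volume_pi_Ioo_lt_top p q)).ne
  -- If `H` has density at most `α` in `R`, then `R` is defective for `K`, `H`, `c`.
  by_contra hcon
  refine not_isDefective hK.isClosed hHo (fun y hy => (hKsub hy).1.2) hc0.le
    (fun p q hpq hpqK => hbox p q hpq ?_) a b ⟨hab, ?_, ?_⟩
  · refine lt_of_lt_of_le ?_ (hmono p q)
    rw [hpqK]
    exact mul_lt_mul_of_pos_right hc1 (hpos p q hpq)
  · refine (hmono a b).trans (h1.trans ?_)
    exact mul_le_mul_of_nonneg_right hc1.le hv.le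
  · rw [← hR, hKR]
    refine lt_of_le_of_lt ?_ hKv
    exact mul_le_mul_of_nonneg_left (not_lt.1 hcon) hc0.le

theorem volume_haloSet_le {n : ℕ} (α : ℝ) {E : Set (Fin n → ℝ)} (hE : MeasurableSet E)
    (hfin : volume E < ∞) :
    volume (haloSet (strongBasis n) α E) ≤
      sharpTauberianConstant (strongBasis n) α * volume E := by
  rcases eq_or_ne (volume E) 0 with h0 | h0
  · have : haloSet (strongBasis n) α E = ∅ := by
      refine eq_empty_of_forall_notMem fun x hx => ?_
      obtain ⟨a, b, -, -, h⟩ := (mem_haloSet_strongBasis hE).1 hx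
      rw [measure_mono_null inter_subset_left h0] at h
      exact not_lt_zero h
    simp [this]
  · rw [← ENNReal.div_le_iff h0 hfin.ne]
    exact le_iSup₂_of_le E hE (le_iSup₂_of_le (pos_iff_ne_zero.2 h0) hfin le_rfl)

theorem sharpTauberianConstant_le {n : ℕ} {α : ℝ} {C : ℝ≥0∞}
    (h : ∀ E : Set (Fin n → ℝ), MeasurableSet E → volume E < ∞ →
      volume (haloSet (strongBasis n) α E) ≤ C * volume E) :
    sharpTauberianConstant (strongBasis n) α ≤ C :=
  iSup₂_le fun E hE => iSup₂_le fun h0 hfin => (ENNReal.div_le_iff h0.ne' hfin.ne).2 (h E hE hfin)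

theorem sharpTauberianConstant_anti {n : ℕ} {α β : ℝ} (h : α ≤ β) :
    sharpTauberianConstant (strongBasis n) β ≤ sharpTauberianConstant (strongBasis n) α :=
  sharpTauberianConstant_le fun E hE hfin =>
    (measure_mono (haloSet_anti _ h E)).trans (volume_haloSet_le α hE hfin)

theorem sharpTauberianConstant_mul_le {n : ℕ} (hn : 1 ≤ n) {α β : ℝ} (hα : α ∈ Ioo (0 : ℝ) 1)
    (hβ : β ∈ Ioo (0 : ℝ) 1) (hfin : sharpTauberianConstant (strongBasis n) β < ∞) :
    sharpTauberianConstant (strongBasis n) (α * β) ≤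
      sharpTauberianConstant (strongBasis n) α * sharpTauberianConstant (strongBasis n) β := by
  refine sharpTauberianConstant_le fun E hE hEfin => ?_
  have h1 := volume_haloSet_le β hE hEfin
  refine (measure_mono (haloSet_mul_subset hn hα hβ hE)).trans ?_
  refine (volume_haloSet_le α (isOpen_haloSet_strongBasis hE).measurableSet
    (h1.trans_lt (ENNReal.mul_lt_top hfin hEfin))).trans ?_
  rw [mul_assoc]
  gcongr

/-! ### The halo estimate on the line. -/

/-- A finite family of open intervals has a subfamily with the same union in which no point lies
in more than two intervals. -/
theorem exists_subfamily_card_le_two (t : Finset (ℝ × ℝ)) :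
    ∃ s ⊆ t, (⋃ p ∈ s, Ioo p.1 p.2) = (⋃ p ∈ t, Ioo p.1 p.2) ∧
      ∀ x, (s.filter fun p => x ∈ Ioo p.1 p.2).card ≤ 2 := by
  classical
  obtain ⟨s, hs, hmin⟩ := Finset.exists_min_image
    (t.powerset.filter fun s => (⋃ p ∈ s, Ioo p.1 p.2) = (⋃ p ∈ t, Ioo p.1 p.2)) Finset.card
    ⟨t, by simp⟩
  simp only [Finset.mem_filter, Finset.mem_powerset] at hs hmin
  refine ⟨s, hs.1, hs.2, fun x => ?_⟩
  by_contra! hcard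
  set F := s.filter fun p => x ∈ Ioo p.1 p.2 with hF
  have hne : F.Nonempty := Finset.card_pos.1 (by omega)
  -- Among at least three intervals through `x`, one reaching furthest left and one reaching
  -- furthest right cover any third, `u`; deleting `u` contradicts minimality.
  obtain ⟨p, hp, hpmin⟩ := Finset.exists_min_image F Prod.fst hne
  obtain ⟨q, hq, hqmax⟩ := Finset.exists_max_image F Prod.snd hne
  obtain ⟨u, hu, hupq⟩ := Finset.exists_mem_notMem_of_card_lt_card
    (s := {p, q}) (t := F) (Finset.card_le_two.trans_lt hcard)
  simp only [Finset.mem_insert, Finset.mem_singleton, not_or] at hupq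
  have hpF := (Finset.mem_filter.1 hp)
  have hqF := (Finset.mem_filter.1 hq)
  have huF := (Finset.mem_filter.1 hu)
  have hle := hmin (s.erase u) ⟨(Finset.erase_subset _ _).trans hs.1, ?_⟩
  · have := Finset.card_erase_lt_of_mem huF.1
    omega
  rw [← hs.2]
  refine (biUnion_subset_biUnion_left fun y hy => Finset.mem_of_mem_erase hy).antisymm ?_
  refine iUnion₂_subset fun v hv y hy => ?_
  simp only [mem_iUnion, exists_prop]
  by_cases hvu : v = u
  · subst hvu
    by_cases hyp : y < p.2
    · exact ⟨p, Finset.mem_erase.2 ⟨fun h => hupq.1 h.symm, hpF.1⟩,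
        (hpmin v hu).trans_lt hy.1, hyp⟩
    · exact ⟨q, Finset.mem_erase.2 ⟨fun h => hupq.2 h.symm, hqF.1⟩,
        hqF.2.1.trans (hpF.2.2.trans_le (not_lt.1 hyp)), hy.2.trans_le (hqmax v hu)⟩
  · exact ⟨v, Finset.mem_erase.2 ⟨hvu, hv⟩, hy⟩

theorem sum_volume_Ioo_le (s : Finset (ℝ × ℝ))
    (hs : ∀ x, (s.filter fun p => x ∈ Ioo p.1 p.2).card ≤ 2) :
    ∑ p ∈ s, volume (Ioo p.1 p.2) ≤ 2 * volume (⋃ p ∈ s, Ioo p.1 p.2) := by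
  have hm : MeasurableSet (⋃ p ∈ s, Ioo p.1 p.2) :=
    s.measurableSet_biUnion fun p _ => measurableSet_Ioo
  calc ∑ p ∈ s, volume (Ioo p.1 p.2)
      = ∑ p ∈ s, ∫⁻ x, (Ioo p.1 p.2).indicator 1 x :=
        Finset.sum_congr rfl fun p _ => (lintegral_indicator_one measurableSet_Ioo).symm
    _ = ∫⁻ x, ∑ p ∈ s, (Ioo p.1 p.2).indicator 1 x :=
        (lintegral_finsetSum _ fun p _ => measurable_one.indicator measurableSet_Ioo).symm
    _ ≤ ∫⁻ x, 2 * (⋃ p ∈ s, Ioo p.1 p.2).indicator 1 x := by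
        refine lintegral_mono fun x => ?_
        by_cases hx : x ∈ ⋃ p ∈ s, Ioo p.1 p.2
        · simp only [hx, indicator_of_mem, Pi.one_apply, mul_one]
          have : ∑ p ∈ s, (Ioo p.1 p.2).indicator (1 : ℝ → ℝ≥0∞) x =
              ((s.filter fun p => x ∈ Ioo p.1 p.2).card : ℝ≥0∞) := by
            classical
            simp only [indicator_apply, Pi.one_apply, Finset.sum_boole]
          rw [this]
          exact_mod_cast hs x
        · refine le_of_eq_of_le (Finset.sum_eq_zero fun p hp => ?_) zero_le
          exact indicator_of_notMem (fun h => hx (mem_biUnion (Finset.mem_coe.2 hp) h)) _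
    _ = 2 * volume (⋃ p ∈ s, Ioo p.1 p.2) := by
        rw [lintegral_const_mul _ (measurable_one.indicator hm), lintegral_indicator_one hm]

/-- The points of the line lying in an interval on which `U` has density more than `α`. -/
def intervalHalo (α : ℝ) (U : Set ℝ) : Set ℝ :=
  {x | ∃ a b, x ∈ Ioo a b ∧ ENNReal.ofReal α * volume (Ioo a b) < volume (U ∩ Ioo a b)}

/-- After thinning to multiplicity two, the part of the union `W` outside `U` has measure at most `η
* ∑ |I| ≤ 2 * η * |W|`, so `(1 - 2 * η) * |W| ≤ |U|`. -/
theorem volume_biUnion_Ioo_le {η : ℝ} (h0 : 0 < η) (h1 : η ≤ 1 / 4) {U : Set ℝ}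
    (hU : MeasurableSet U) (hfin : volume U ≠ ∞) (t : Finset (ℝ × ℝ))
    (ht : ∀ p ∈ t, ENNReal.ofReal (1 - η) * volume (Ioo p.1 p.2) < volume (U ∩ Ioo p.1 p.2)) :
    volume (⋃ p ∈ t, Ioo p.1 p.2) ≤ ENNReal.ofReal (1 + 4 * η) * volume U := by
  obtain ⟨s, hst, hun, hcard⟩ := exists_subfamily_card_le_two t
  rw [← hun]
  have hsum := sum_volume_Ioo_le s hcard
  set W := ⋃ p ∈ s, Ioo p.1 p.2 with hW
  have hWm : MeasurableSet W := s.measurableSet_biUnion fun p _ => measurableSet_Ioo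
  have hWfin : volume W ≠ ∞ :=
    ((measure_biUnion_finset_le s _).trans_lt (ENNReal.sum_lt_top.2 fun p _ => by simp)).ne
  have hI : ∀ p ∈ s, volume.real (Ioo p.1 p.2 \ U) ≤ η * volume.real (Ioo p.1 p.2) := by
    intro p hp
    have h2 := ht p (hst hp)
    have h3 : (volume (Ioo p.1 p.2)) ≠ ∞ := by simp
    rw [← ENNReal.toReal_lt_toReal (ENNReal.mul_ne_top ENNReal.ofReal_ne_top h3)
      (measure_ne_top_of_subset inter_subset_right h3), ENNReal.toReal_mul,
      ENNReal.toReal_ofReal (by linarith)] at h2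
    have h4 := measureReal_inter_add_sdiff (μ := volume) (s := Ioo p.1 p.2) hU h3
    rw [inter_comm] at h4
    simp only [Measure.real] at h4 ⊢
    linarith
  have hsumR : ∑ p ∈ s, volume.real (Ioo p.1 p.2) ≤ 2 * volume.real W := by
    have := ENNReal.toReal_mono (ENNReal.mul_ne_top (by simp) hWfin) hsum
    rw [ENNReal.toReal_sum (fun p _ => by simp), ENNReal.toReal_mul] at this
    simpa [Measure.real] using this
  have hdiff : volume.real (W \ U) ≤ η * (2 * volume.real W) := by
    have : W \ U = ⋃ p ∈ s, (Ioo p.1 p.2 \ U) := by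
      simp only [hW, iUnion_sdiff]
    rw [this]
    refine (measureReal_biUnion_finset_le s _).trans ((Finset.sum_le_sum hI).trans ?_)
    rw [← Finset.mul_sum]
    exact mul_le_mul_of_nonneg_left hsumR h0.le
  have hsplit := measureReal_inter_add_sdiff (μ := volume) (s := W) hU hWfin
  have hWU : volume.real (W ∩ U) ≤ volume.real U := measureReal_mono inter_subset_right hfin
  have hfinal : volume.real W ≤ (1 + 4 * η) * volume.real U := by
    have hw : 0 ≤ volume.real W := measureReal_nonneg
    have h5 : (1 - 2 * η) * volume.real W ≤ volume.real U := by linarith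
    have h6 := mul_le_mul_of_nonneg_left h5 (by linarith : 0 ≤ 1 + 4 * η)
    -- The product is `1 + 2 * η * (1 - 4 * η)`; this is where `η ≤ 1/4` is needed.
    have h7 : 1 ≤ (1 + 4 * η) * (1 - 2 * η) := by nlinarith
    nlinarith
  rw [← ENNReal.toReal_le_toReal hWfin (ENNReal.mul_ne_top ENNReal.ofReal_ne_top hfin),
    ENNReal.toReal_mul, ENNReal.toReal_ofReal (by linarith)]
  exact hfinal

theorem isOpen_intervalHalo (α : ℝ) (U : Set ℝ) : IsOpen (intervalHalo α U) := by
  rw [isOpen_iff_mem_nhds]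
  rintro x ⟨a, b, hx, h⟩
  exact Filter.mem_of_superset (isOpen_Ioo.mem_nhds hx) fun y hy => ⟨a, b, hy, h⟩

theorem volume_intervalHalo_le {η : ℝ} (h0 : 0 < η) (h1 : η ≤ 1 / 4) {U : Set ℝ}
    (hU : MeasurableSet U) :
    volume (intervalHalo (1 - η) U) ≤ ENNReal.ofReal (1 + 4 * η) * volume U := by
  rcases eq_or_ne (volume U) ∞ with hfin | hfin
  · rw [hfin, ENNReal.mul_top (by simp; linarith)]
    exact le_top
  rw [(isOpen_intervalHalo _ U).measure_eq_iSup_isCompact]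
  refine iSup₂_le fun K hK => iSup_le fun hKc => ?_
  obtain ⟨T, hT, hTfin, hKT⟩ := hKc.elim_finite_subcover_image (c := fun p : ℝ × ℝ => Ioo p.1 p.2)
    (b := {p | ENNReal.ofReal (1 - η) * volume (Ioo p.1 p.2) < volume (U ∩ Ioo p.1 p.2)})
    (fun p _ => isOpen_Ioo) (fun x hx => by
      obtain ⟨a, b, hx, h⟩ := hK hx
      exact mem_biUnion (x := (a, b)) h hx)
  refine (measure_mono hKT).trans ?_
  have := volume_biUnion_Ioo_le h0 h1 hU hfin hTfin.toFinset fun p hp =>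
    hT (hTfin.mem_toFinset.1 hp)
  simpa using this

/-! ### Slicing and Solyanik's estimate. -/

/-- A compact part of the slice carrying measure above `c` stays inside `W` for nearby `x`, by the
tube lemma. This keeps the slice-wise halos open, hence measurable for Fubini. -/
theorem isOpen_setOf_lt_measure_slice {X Y : Type*} [TopologicalSpace X] [TopologicalSpace Y]
    [MeasurableSpace Y] (μ : Measure Y) [μ.Regular] {W : Set (X × Y)} (hW : IsOpen W)
    {J : Set Y} (hJ : IsOpen J) (c : ℝ≥0∞) : IsOpen {x | c < μ (Prod.mk x ⁻¹' W ∩ J)} := by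
  rw [isOpen_iff_mem_nhds]
  intro x hx
  obtain ⟨K, hKsub, hK, hKc⟩ :=
    ((hW.preimage (Continuous.prodMk_right x)).inter hJ).exists_lt_isCompact hx
  obtain ⟨u, v, hu, -, hxu, hKv, huv⟩ := generalized_tube_lemma (isCompact_singleton (x := x)) hK hW
    (by
      rintro ⟨y, z⟩ ⟨rfl, hz⟩
      exact (hKsub hz).1)
  refine Filter.mem_of_superset (hu.mem_nhds (hxu rfl)) fun y hy => ?_
  exact hKc.trans_le (measure_mono fun z hz => ⟨huv ⟨hy, hKv hz⟩, (hKsub hz).2⟩)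

/-- A set of density more than `1 - η * δ` in a product has, for more than the proportion `1 - δ`
of the slices, density more than `1 - η` in the slice. -/
theorem lt_measure_setOf_lt_measure_slice {X Y : Type*} [MeasurableSpace X] [MeasurableSpace Y]
    (μ : Measure X) (ν : Measure Y) [SFinite μ] [SFinite ν] {W : Set (X × Y)} (hW : MeasurableSet W)
    {I : Set X} {J : Set Y} (hI : MeasurableSet I) (hJ : MeasurableSet J) (hIf : μ I ≠ ∞)
    (hJf : ν J ≠ ∞) {η δ : ℝ} (h0 : 0 < η) (h1 : η ≤ 1) (hδ : δ ≤ 1)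
    (h : ENNReal.ofReal (1 - η * δ) * (μ I * ν J) < μ.prod ν (W ∩ I ×ˢ J)) :
    ENNReal.ofReal (1 - δ) * ν J <
      ν ({y | ENNReal.ofReal (1 - η) * μ I < μ ((fun x => (x, y)) ⁻¹' W ∩ I)} ∩ J) := by
  set G := {y | ENNReal.ofReal (1 - η) * μ I < μ ((fun x => (x, y)) ⁻¹' W ∩ I)} with hG
  have hGm : MeasurableSet G := by
    refine measurableSet_lt measurable_const ?_
    have := measurable_measure_prodMk_right (μ := μ) (hW.inter (hI.prod MeasurableSet.univ))
    refine (congrArg Measurable (funext fun y => ?_)).mp this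
    congr 1
    ext x
    simp
  by_contra hcon
  rw [not_lt] at hcon
  -- Chebyshev by Fubini: good slices contribute at most `μ I`, bad ones at most `(1 - η) * μ I`.
  have hle : μ.prod ν (W ∩ I ×ˢ J) ≤
      μ I * ν (G ∩ J) + ENNReal.ofReal (1 - η) * μ I * ν (J \ G) := by
    rw [Measure.prod_apply_symm (hW.inter (hI.prod hJ)),
      ← lintegral_indicator_const (hGm.inter hJ), ← lintegral_indicator_const (hJ.diff hGm),
      ← lintegral_add_left (measurable_const.indicator (hGm.inter hJ))]
    refine lintegral_mono fun y => ?_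
    by_cases hyJ : y ∈ J
    · by_cases hyG : y ∈ G
      · simp only [indicator, mem_inter_iff, hyG, hyJ, mem_sdiff, and_self, not_true, and_false,
          if_true, if_false, add_zero]
        exact measure_mono fun x hx => hx.2.1
      · simp only [indicator, mem_inter_iff, hyG, hyJ, mem_sdiff, false_and, not_false_eq_true,
          and_self, if_true, if_false, zero_add]
        refine le_trans (measure_mono fun x hx => ?_) (not_lt.1 hyG)
        exact ⟨hx.1, hx.2.1⟩
    · have : (fun x => (x, y)) ⁻¹' (W ∩ I ×ˢ J) = ∅ := by
        ext x
        simp [hyJ]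
      simp [this]
  have hlt := h.trans_le hle
  have hGJf : ν (G ∩ J) ≠ ∞ := measure_ne_top_of_subset inter_subset_right hJf
  have hJGf : ν (J \ G) ≠ ∞ := measure_ne_top_of_subset sdiff_subset hJf
  have hηδ : 0 ≤ 1 - η * δ := by nlinarith
  rw [← ENNReal.toReal_lt_toReal (by finiteness) (by finiteness),
    ENNReal.toReal_add (by finiteness) (by finiteness)] at hlt
  rw [← ENNReal.toReal_le_toReal (by finiteness) (by finiteness)] at hcon
  simp only [ENNReal.toReal_mul, ENNReal.toReal_ofReal hηδ,
    ENNReal.toReal_ofReal (sub_nonneg.2 h1), ENNReal.toReal_ofReal (sub_nonneg.2 hδ)] at hlt hcon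
  have hsplit := measureReal_inter_add_sdiff (μ := ν) (s := J) hGm hJf
  rw [inter_comm] at hsplit
  simp only [Measure.real] at hsplit
  have hi : 0 ≤ (μ I).toReal := ENNReal.toReal_nonneg
  rw [← hsplit] at hcon hlt
  set i := (μ I).toReal
  set g := (ν (G ∩ J)).toReal
  set d := (ν (J \ G)).toReal
  have h2 := mul_le_mul_of_nonneg_left hcon (mul_nonneg h0.le hi)
  nlinarith

/-- Applying the one-dimensional halo operator along the first coordinate. -/
def sliceHalo {Y : Type*} (α : ℝ) (W : Set (ℝ × Y)) : Set (ℝ × Y) :=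
  {z | z.1 ∈ intervalHalo α ((fun t => (t, z.2)) ⁻¹' W)}

theorem isOpen_sliceHalo {Y : Type*} [TopologicalSpace Y] (α : ℝ) {W : Set (ℝ × Y)}
    (hW : IsOpen W) : IsOpen (sliceHalo α W) := by
  have : sliceHalo α W = ⋃ (a : ℝ) (b : ℝ), Ioo a b ×ˢ
      {y | ENNReal.ofReal α * volume (Ioo a b) <
        volume (Prod.mk y ⁻¹' (Prod.swap ⁻¹' W) ∩ Ioo a b)} := by
    ext z
    simp only [sliceHalo, intervalHalo, mem_iUnion, mem_prod, mem_ofPred_eq]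
    rfl
  rw [this]
  exact isOpen_iUnion fun a => isOpen_iUnion fun b => isOpen_Ioo.prod
    (isOpen_setOf_lt_measure_slice volume (hW.preimage continuous_swap) isOpen_Ioo _)

theorem measure_sliceHalo_le {Y : Type*} [TopologicalSpace Y] [SecondCountableTopology Y]
    [MeasurableSpace Y] [BorelSpace Y] (ν : Measure Y) [SFinite ν] {η : ℝ} (h0 : 0 < η)
    (h1 : η ≤ 1 / 4) {W : Set (ℝ × Y)} (hW : IsOpen W) :
    (volume.prod ν) (sliceHalo (1 - η) W) ≤
      ENNReal.ofReal (1 + 4 * η) * (volume.prod ν) W := by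
  rw [Measure.prod_apply_symm (isOpen_sliceHalo _ hW).measurableSet,
    Measure.prod_apply_symm hW.measurableSet,
    ← lintegral_const_mul _ (measurable_measure_prodMk_right hW.measurableSet)]
  exact lintegral_mono fun y =>
    volume_intervalHalo_le h0 h1 (hW.preimage (Continuous.prodMk_left y)).measurableSet

/-- The strong halo operator applied in the slices of fixed first coordinate preserves openness. -/
theorem isOpen_setOf_mem_haloSet_slice {n : ℕ} (α : ℝ) {W : Set (ℝ × (Fin n → ℝ))}
    (hW : IsOpen W) :
    IsOpen {z : ℝ × (Fin n → ℝ) | z.2 ∈ haloSet (strongBasis n) α (Prod.mk z.1 ⁻¹' W)} := by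
  have : {z : ℝ × (Fin n → ℝ) | z.2 ∈ haloSet (strongBasis n) α (Prod.mk z.1 ⁻¹' W)} =
      ⋃ (a : Fin n → ℝ) (b : Fin n → ℝ) (_ : ∀ i, a i < b i),
      {x | ENNReal.ofReal α * volume (univ.pi fun i => Ioo (a i) (b i)) <
        volume (Prod.mk x ⁻¹' W ∩ univ.pi fun i => Ioo (a i) (b i))} ×ˢ
        univ.pi fun i => Ioo (a i) (b i) := by
    ext z
    simp only [mem_ofPred_eq, mem_haloSet_strongBasis
      (hW.preimage (Continuous.prodMk_right z.1)).measurableSet, mem_iUnion, mem_prod, exists_prop,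
      and_comm]
  rw [this]
  exact isOpen_iUnion fun a => isOpen_iUnion fun b => isOpen_iUnion fun _ =>
    (isOpen_setOf_lt_measure_slice volume hW
      (isOpen_set_pi finite_univ fun i _ => isOpen_Ioo) _).prod
      (isOpen_set_pi finite_univ fun i _ => isOpen_Ioo)

theorem measure_setOf_mem_haloSet_slice_le {n : ℕ} {α : ℝ} {c : ℝ≥0∞}
    (h : ∀ U : Set (Fin n → ℝ), IsOpen U → volume (haloSet (strongBasis n) α U) ≤ c * volume U)
    {W : Set (ℝ × (Fin n → ℝ))} (hW : IsOpen W) :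
    volume {z : ℝ × (Fin n → ℝ) | z.2 ∈ haloSet (strongBasis n) α (Prod.mk z.1 ⁻¹' W)} ≤
      c * volume W := by
  rw [Measure.volume_eq_prod,
    Measure.prod_apply (isOpen_setOf_mem_haloSet_slice α hW).measurableSet,
    Measure.prod_apply hW.measurableSet,
    ← lintegral_const_mul _ (measurable_measure_prodMk_left hW.measurableSet)]
  refine lintegral_mono fun x => ?_
  have hx : Prod.mk x ⁻¹' {z : ℝ × (Fin n → ℝ) |
      z.2 ∈ haloSet (strongBasis n) α (Prod.mk z.1 ⁻¹' W)} =
      haloSet (strongBasis n) α (Prod.mk x ⁻¹' W) := by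
    ext y
    simp only [mem_preimage, mem_ofPred_eq]
  simp only [hx]
  exact h (Prod.mk x ⁻¹' W) (hW.preimage (Continuous.prodMk_right x))

/-- Solyanik's estimate for open sets. -/
theorem volume_haloSet_le_of_isOpen {η : ℝ} (h0 : 0 < η) (h1 : η ≤ 1 / 4) (n : ℕ)
    {U : Set (Fin n → ℝ)} (hU : IsOpen U) :
    volume (haloSet (strongBasis n) (1 - η ^ n) U) ≤
      ENNReal.ofReal (1 + 4 * η) ^ n * volume U := by
  induction n with
  | zero =>
    -- In dimension zero the level is `1 - η ^ 0 = 0` and the space is one point, so a nonempty halo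
    -- forces `U` to contain that point.
    rw [pow_zero (ENNReal.ofReal _), one_mul]
    refine measure_mono fun x hx => ?_
    obtain ⟨a, b, -, -, h⟩ := (mem_haloSet_strongBasis hU.measurableSet).1 hx
    obtain ⟨y, hy⟩ := nonempty_of_measure_ne_zero (zero_le.trans_lt h).ne'
    exact Subsingleton.elim x y ▸ hy.1
  | succ n ih =>
    set e := MeasurableEquiv.piFinSuccAbove (fun _ : Fin (n + 1) => ℝ) 0 with he
    have hmp : MeasurePreserving e := volume_preserving_piFinSuccAbove (fun _ => ℝ) 0
    have hec : Continuous e.symm := by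
      refine continuous_pi fun i => ?_
      refine Fin.cases ?_ (fun i => ?_) i
      · simpa [he, MeasurableEquiv.piFinSuccAbove_symm_apply] using continuous_fst
      · simpa [he, MeasurableEquiv.piFinSuccAbove_symm_apply] using
          (continuous_apply i).comp' continuous_snd
    set W := e.symm ⁻¹' U with hWdef
    have hW : IsOpen W := hU.preimage hec
    have hUW : e ⁻¹' W = U := by
      ext x
      simp [hWdef]
    set W1 := sliceHalo (1 - η) W with hW1def
    have hW1 : IsOpen W1 := isOpen_sliceHalo _ hW
    set W2 := {z : ℝ × (Fin n → ℝ) |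
      z.2 ∈ haloSet (strongBasis n) (1 - η ^ n) (Prod.mk z.1 ⁻¹' W1)} with hW2def
    have hW2 : IsOpen W2 := isOpen_setOf_mem_haloSet_slice _ hW1
    -- The slice lemma is applied with `δ = η ^ n`: more than the proportion `1 - η ^ n` of `J`
    -- consists of `y` whose slice has density above `1 - η` in `I`, so all of `I` lies in that
    -- slice of `W1`.
    have hsub : haloSet (strongBasis (n + 1)) (1 - η ^ (n + 1)) U ⊆ e ⁻¹' W2 := by
      intro x hx
      obtain ⟨a, b, hab, hxR, h⟩ := (mem_haloSet_strongBasis hU.measurableSet).1 hx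
      set I := Ioo (a 0) (b 0) with hI
      set J := univ.pi fun i : Fin n => Ioo (a i.succ) (b i.succ) with hJ
      have hR : (univ.pi fun i => Ioo (a i) (b i)) = e ⁻¹' (I ×ˢ J) := by
        ext y
        simp [he, hI, hJ, MeasurableEquiv.piFinSuccAbove, Fin.forall_fin_succ, Fin.tail]
      have hIm : MeasurableSet I := measurableSet_Ioo
      have hJm : MeasurableSet J := MeasurableSet.univ_pi fun i => measurableSet_Ioo
      rw [hR] at h hxR
      rw [← hUW, ← preimage_inter, hmp.measure_preimage (hIm.prod hJm).nullMeasurableSet,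
        hmp.measure_preimage (hW.measurableSet.inter (hIm.prod hJm)).nullMeasurableSet, pow_succ',
        Measure.volume_eq_prod, Measure.prod_prod] at h
      have hs := lt_measure_setOf_lt_measure_slice volume volume hW.measurableSet hIm hJm
        (by simp [hI]) (volume_pi_Ioo_lt_top _ _).ne h0 (by linarith)
        (pow_le_one₀ h0.le (by linarith)) h
      refine (mem_haloSet_strongBasis (hW1.preimage (Continuous.prodMk_right _)).measurableSet).2
        ⟨_, _, fun i => hab i.succ, hxR.2, hs.trans_le (measure_mono ?_)⟩
      exact inter_subset_inter_left _ fun y hy => ⟨a 0, b 0, hxR.1, hy⟩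
    calc volume (haloSet (strongBasis (n + 1)) (1 - η ^ (n + 1)) U)
        ≤ volume W2 := by
          rw [← hmp.measure_preimage hW2.measurableSet.nullMeasurableSet]
          exact measure_mono hsub
      _ ≤ ENNReal.ofReal (1 + 4 * η) ^ n * volume W1 := 
          measure_setOf_mem_haloSet_slice_le (fun U hU => ih hU) hW1
      _ ≤ ENNReal.ofReal (1 + 4 * η) ^ n * (ENNReal.ofReal (1 + 4 * η) * volume W) := by
          exact mul_le_mul_right (measure_sliceHalo_le volume h0 h1 hW) _
      _ = ENNReal.ofReal (1 + 4 * η) ^ (n + 1) * volume U := by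
          rw [← mul_assoc, ← pow_succ, ← hUW,
            hmp.measure_preimage hW.measurableSet.nullMeasurableSet]

/-- Solyanik's estimate for the strong maximal operator. -/
theorem sharpTauberianConstant_one_sub_pow_le {n : ℕ} {η : ℝ} (h0 : 0 < η) (h1 : η ≤ 1 / 4) :
    sharpTauberianConstant (strongBasis n) (1 - η ^ n) ≤ ENNReal.ofReal (1 + 4 * η) ^ n := by
  refine sharpTauberianConstant_le fun E hE hfin => ?_
  have hc0 : ENNReal.ofReal (1 + 4 * η) ^ n ≠ 0 := by
    refine pow_ne_zero _ ?_
    simp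
    linarith
  have hct : ENNReal.ofReal (1 + 4 * η) ^ n ≠ ∞ := by finiteness
  rw [mul_comm, ← ENNReal.div_le_iff hc0 hct, E.measure_eq_iInf_isOpen volume]
  refine le_iInf₂ fun U hEU => le_iInf fun hU => ?_
  rw [ENNReal.div_le_iff hc0 hct, mul_comm]
  exact (measure_mono (haloSet_mono _ hEU)).trans (volume_haloSet_le_of_isOpen h0 h1 n hU)

/-! ### Finiteness and Hölder continuity. -/

theorem sharpTauberianConstant_lt_top {n : ℕ} (hn : 1 ≤ n) {α : ℝ} (hα : α ∈ Ioo (0 : ℝ) 1) :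
    sharpTauberianConstant (strongBasis n) α < ∞ := by
  -- The smallest level that Solyanik's estimate covers, at `η = 1/4`.
  set r : ℝ := 1 - (1 / 4) ^ n with hr
  have hq0 : (0 : ℝ) < (1 / 4) ^ n := by positivity
  have hq1 : (1 / 4 : ℝ) ^ n < 1 := pow_lt_one₀ (by norm_num) (by norm_num) (by omega)
  have hr0 : 0 < r := by linarith
  have hr1 : r < 1 := by linarith
  have hC : sharpTauberianConstant (strongBasis n) r < ∞ :=
    (sharpTauberianConstant_one_sub_pow_le (by norm_num) le_rfl).trans_lt (by finiteness)
  have hpow : ∀ k : ℕ, sharpTauberianConstant (strongBasis n) (r ^ (k + 1)) < ∞ := by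
    intro k
    induction k with
    | zero => simpa using hC
    | succ k ih =>
      rw [pow_succ']
      exact (sharpTauberianConstant_mul_le hn ⟨hr0, hr1⟩
        ⟨by positivity, pow_lt_one₀ hr0.le hr1 (by omega)⟩ ih).trans_lt (ENNReal.mul_lt_top hC ih)
  obtain ⟨k, hk⟩ := exists_pow_lt_of_lt_one hα.1 hr1
  refine (sharpTauberianConstant_anti (le_trans ?_ hk.le)).trans_lt (hpow k)
  exact pow_le_pow_of_le_one hr0.le hr1.le (Nat.le_succ k)

/-- The chord of a convex function on `[0, 1]`; it makes `(1 + 4 * η) ^ n - 1` linear in `η`. -/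
theorem one_add_pow_le {t : ℝ} (h0 : 0 ≤ t) (h1 : t ≤ 1) (n : ℕ) :
    (1 + t) ^ n ≤ 1 + (2 ^ n - 1) * t := by
  induction n with
  | zero => simp
  | succ n ih =>
    have h2 : (1 : ℝ) ≤ 2 ^ n := one_le_pow₀ (by norm_num)
    have h3 : (2 ^ n - 1) * (t * t) ≤ (2 ^ n - 1) * t :=
      mul_le_mul_of_nonneg_left (mul_le_of_le_one_left h0 h1) (by linarith)
    calc (1 + t) ^ (n + 1) = (1 + t) ^ n * (1 + t) := pow_succ _ _
      _ ≤ (1 + (2 ^ n - 1) * t) * (1 + t) := mul_le_mul_of_nonneg_right ih (by linarith)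
      _ ≤ 1 + (2 ^ (n + 1) - 1) * t := by rw [pow_succ]; linarith

theorem toReal_sharpTauberianConstant_sub_le {n : ℕ} (hn : 1 ≤ n) {a x y : ℝ} (ha : 0 < a)
    (hax : a ≤ x) (hxy : x < y) (hy : y < 1) :
    (sharpTauberianConstant (strongBasis n) x).toReal -
      (sharpTauberianConstant (strongBasis n) y).toReal ≤
    4 * 2 ^ n * (sharpTauberianConstant (strongBasis n) a).toReal *
      ((y - x) / a) ^ (1 / (n : ℝ)) := by
  set c : ℝ → ℝ := fun t => (sharpTauberianConstant (strongBasis n) t).toReal with hc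
  change c x - c y ≤ 4 * 2 ^ n * c a * _
  have hx0 : 0 < x := ha.trans_le hax
  have hy0 : 0 < y := hx0.trans hxy
  have hanti : ∀ s t, a ≤ s → s ≤ t → t < 1 → c t ≤ c s := fun s t hs hst ht =>
    ENNReal.toReal_mono
      (sharpTauberianConstant_lt_top hn ⟨ha.trans_le hs, hst.trans_lt ht⟩).ne
      (sharpTauberianConstant_anti hst)
  have hca : 0 ≤ c a := ENNReal.toReal_nonneg
  have hcy : 0 ≤ c y := ENNReal.toReal_nonneg
  have hn0 : n ≠ 0 := by omega
  have hr : x / y ∈ Ioo (0 : ℝ) 1 := ⟨by positivity, (div_lt_one hy0).2 hxy⟩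
  -- Chosen so that `1 - η ^ n = x / y`, the factor taking level `y` to level `x`.
  set η : ℝ := (1 - x / y) ^ (1 / (n : ℝ)) with hη
  have hη0 : 0 < η := Real.rpow_pos_of_pos (by linarith [hr.2]) _
  have hηn : 1 - η ^ n = x / y := by
    rw [hη, one_div, Real.rpow_inv_natCast_pow (by linarith [hr.2]) hn0]
    ring
  have hηle : η ≤ ((y - x) / a) ^ (1 / (n : ℝ)) := by
    refine Real.rpow_le_rpow (by linarith [hr.2]) ?_ (by positivity)
    rw [one_sub_div hy0.ne']
    exact div_le_div_of_nonneg_left (by linarith) ha (by linarith)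
  suffices c x - c y ≤ 4 * 2 ^ n * c a * η from
    this.trans (mul_le_mul_of_nonneg_left hηle (by positivity))
  have h2n : (1 : ℝ) ≤ 2 ^ n := one_le_pow₀ (by norm_num)
  rcases le_or_gt η (1 / 4) with h | h
  · have h1 : c (x / y) ≤ (1 + 4 * η) ^ n := by
      have := ENNReal.toReal_mono (by finiteness)
        (sharpTauberianConstant_one_sub_pow_le (n := n) hη0 h)
      rwa [hηn, ENNReal.toReal_pow, ENNReal.toReal_ofReal (by linarith)] at this
    have hyI : y ∈ Ioo (0 : ℝ) 1 := ⟨hy0, hy⟩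
    have h2 : c x ≤ c (x / y) * c y := by
      have hfin := sharpTauberianConstant_lt_top hn hyI
      have := ENNReal.toReal_mono (ENNReal.mul_ne_top (sharpTauberianConstant_lt_top hn hr).ne
        hfin.ne) (sharpTauberianConstant_mul_le hn hr hyI hfin)
      rwa [div_mul_cancel₀ _ hy0.ne', ENNReal.toReal_mul] at this
    have h3 := one_add_pow_le (t := 4 * η) (by linarith) (by linarith) n
    calc c x - c y ≤ (1 + (2 ^ n - 1) * (4 * η)) * c y - c y := by
          linarith [mul_le_mul_of_nonneg_right (h1.trans h3) hcy]
      _ = (2 ^ n - 1) * (4 * η) * c y := by ring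
      _ ≤ 2 ^ n * (4 * η) * c a := by
          refine mul_le_mul ?_ (hanti a y le_rfl (by linarith) hy) hcy (by positivity)
          exact mul_le_mul_of_nonneg_right (by linarith) (by linarith)
      _ = 4 * 2 ^ n * c a * η := by ring
  -- For `η > 1/4` the points are far apart, and the trivial bound `c a` suffices because `4 * η >
  -- 1`.
  · have h1 : c x ≤ c a := hanti a x le_rfl hax (by linarith)
    have h2 : 1 ≤ 2 ^ n * (4 * η) := one_le_mul_of_one_le_of_one_le h2n (by linarith)
    calc c x - c y ≤ 1 * c a := by linarith
      _ ≤ 2 ^ n * (4 * η) * c a := mul_le_mul_of_nonneg_right h2 hca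
      _ = 4 * 2 ^ n * c a * η := by ring

theorem mainTheorem5 (n : ℕ) (hn : 1 ≤ n) :
    (∀ α ∈ Set.Ioo (0 : ℝ) 1, sharpTauberianConstant (strongBasis n) α < ∞) ∧
    IsLocallyHolderOn (1 / (n : ℝ≥0))
      (fun α : ℝ => (sharpTauberianConstant (strongBasis n) α).toReal) (Set.Ioo 0 1) := by
  refine ⟨fun α hα => sharpTauberianConstant_lt_top hn hα, fun K hK hKc => ?_⟩
  rcases K.eq_empty_or_nonempty with rfl | hne
  · exact ⟨0, holderOnWith_empty _ _ _⟩
  obtain ⟨a, haK, ha⟩ := hKc.exists_isLeast hne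
  have ha0 : 0 < a := (hK haK).1
  set c : ℝ → ℝ := fun t => (sharpTauberianConstant (strongBasis n) t).toReal with hc
  have hca : 0 ≤ c a := ENNReal.toReal_nonneg
  have hA : 0 ≤ 4 * 2 ^ n * c a * (1 / a) ^ (1 / (n : ℝ)) := by positivity
  have key : ∀ x ∈ K, ∀ y ∈ K, x ≤ y →
      edist (c x) (c y) ≤ (Real.toNNReal (4 * 2 ^ n * c a * (1 / a) ^ (1 / (n : ℝ))) : ℝ≥0∞) *
        edist x y ^ ((1 / (n : ℝ≥0) : ℝ≥0) : ℝ) := by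
    intro x hx y hy hxy
    rcases hxy.eq_or_lt with rfl | hxy
    · simp
    have hle : c y ≤ c x := ENNReal.toReal_mono (sharpTauberianConstant_lt_top hn (hK hx)).ne
      (sharpTauberianConstant_anti hxy.le)
    have hmain := toReal_sharpTauberianConstant_sub_le hn ha0 (ha hx) hxy (hK hy).2
    rw [edist_dist, edist_dist, dist_comm x y, Real.dist_eq, Real.dist_eq,
      abs_of_nonneg (sub_nonneg.2 hle), abs_of_nonneg (sub_nonneg.2 hxy.le),
      ENNReal.ofReal_rpow_of_nonneg (sub_nonneg.2 hxy.le) NNReal.zero_le_coe,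
      ← ENNReal.ofReal.eq_1, ← ENNReal.ofReal_mul hA]
    refine ENNReal.ofReal_le_ofReal (hmain.trans_eq ?_)
    rw [div_eq_mul_one_div, mul_comm (y - x), Real.mul_rpow (by positivity) (by linarith)]
    push_cast
    ring
  refine ⟨Real.toNNReal (4 * 2 ^ n * c a * (1 / a) ^ (1 / (n : ℝ))), fun x hx y hy => ?_⟩
  rcases le_total x y with h | h
  · exact key x hx y hy h
  · rw [edist_comm, edist_comm x y]
    exact key y hy x hx h
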